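/- Let $M$ be a closed (compact, boundaryless, finite-dimensional) smooth manifold, $f:M\to M$ a $C^1$ diffeomorphism and $\rho:M\to(0,\infty)$ a $C^1$ function (for instance $\rho\equiv 1$). Let $\overline M$ be the suspension manifold, the quotient of $M\times\mathbb R$ by the equivalence relation generated by $(x,s+\rho(x))\sim(f(x),s)$, with its quotient $C^1$ structure; let $\phi$ be the suspension flow $\phi_t[x,s]=[x,s+t]$ on $\overline M$, $X_\phi$ its velocity field, and $\pi:\overline M\to M$ the projection with $\pi[x,s]=x$ for $0\le s<\rho(x)$. Let $\alpha:\overline M\to[0,\infty)$ be a $C^1$ function with zero set $S=\{\alpha=0\}$ (possibly uncountable), and let $\psi$ be the singular suspension of $f$ with brake $\alpha$, i.e. the flow on $\overline M$ induced by the vector field $\alpha X_\phi$, whose set of singularities is $S$. Put $$A_{Sing}=\pi\Big(\bigcup_{t\in\mathbb R}\phi_t(S)\Big)\subset M .$$ Suppose that there is a non-atomic ergodic $f$-invariant Borel probability measure $\mu$ on $M$ with metric entropy $h_\mu(f)>0$ and $\operatorname{supp}(\mu)\cap A_{Sing}=\emptyset$. Then $\psi$ has positive topological entropy: $h(\psi)=h(\psi_1)>0$,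 where $h(\psi_1)=\lim_{\varepsilon\to0}\limsup_{n\to\infty}\frac1n\log S(n,\varepsilon)$ and $S(n,\varepsilon)$ is the maximal cardinality of a set $K\subset\overline M$ such that any two distinct points of $K$ are moved to distance greater than $\varepsilon$ by $\psi_1^k$ for some $0\le k\le n$, for any metric on $\overline M$ inducing its topology. -/

import Mathlib

open scoped Manifold ContDiff Topology

noncomputable section

namespace SingularSuspension

open Set Filter MeasureTheory

/-! ### Entropy -/

section Entropy

/-- `K` is an `n`-`ε`-separated set for `T`: distinct points of `K` have orbits which are more than
`ε` apart at some time `0 ≤ k ≤ n`. -/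
def IsSeparatedFor {X : Type*} [MetricSpace X] (T : X → X) (n : ℕ) (ε : ℝ) (K : Set X) : Prop :=
  ∀ x ∈ K, ∀ y ∈ K, x ≠ y → ∃ k ≤ n, ε < dist (T^[k] x) (T^[k] y)

/-- `S(n, ε)`: the maximal cardinality of an `n`-`ε`-separated set. -/
def maxSeparatedCard {X : Type*} [MetricSpace X] (T : X → X) (n : ℕ) (ε : ℝ) : ℕ∞ :=
  ⨆ (K : Finset X) (_ : IsSeparatedFor T n ε (K : Set X)), (K.card : ℕ∞)

/-- Topological entropy `lim_{ε → 0} limsup_n (1/n) log S(n, ε)` of a self-map of a metric space.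
The inner quantity does not increase with `ε`, so its limit as `ε → 0⁺` is its supremum over
`ε > 0`. -/
def topEntropy {X : Type*} [MetricSpace X] (T : X → X) : EReal :=
  ⨆ (ε : ℝ) (_ : 0 < ε),
    limsup (fun n : ℕ => ENNReal.log (maxSeparatedCard T n ε : ENNReal) / (n : EReal)) atTop

variable {X : Type*} [MeasurableSpace X]

/-- Shannon entropy of the partition `𝒫 ∨ T⁻¹𝒫 ∨ ⋯ ∨ T^{-(n-1)}𝒫`, where `𝒫` is the partition into
the fibres of `P`: the atoms of the join are the sets of points with a given `P`-itinerary of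
length `n`. (`Real.negMulLog t = -t log t`.) -/
def joinEntropy (T : X → X) (μ : Measure X) {k : ℕ} (P : X → Fin k) (n : ℕ) : ℝ :=
  ∑ w : Fin n → Fin k, Real.negMulLog (μ.real {x | ∀ i : Fin n, P (T^[i] x) = w i})

/-- The metric entropy `h_μ(T, 𝒫) = lim_n (1/n) H_μ(𝒫_n)` of a partition; for an invariant
probability measure the limit exists, and so equals the upper limit. -/
def partitionEntropy (T : X → X) (μ : Measure X) {k : ℕ} (P : X → Fin k) : EReal :=
  limsup (fun n : ℕ => ((joinEntropy T μ P n / n : ℝ) : EReal)) atTop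

/-- The metric entropy `h_μ(T)`: supremum over all finite measurable partitions. -/
def metricEntropy (T : X → X) (μ : Measure X) : EReal :=
  ⨆ (k : ℕ) (P : X → Fin k) (_ : Measurable P), partitionEntropy T μ P

end Entropy

/-! ### The suspension manifold -/

variable {E : Type*} [NormedAddCommGroup E] [NormedSpace ℝ E]
  {M : Type*} [TopologicalSpace M] [ChartedSpace E M]

/-- A roof function on `M`: a positive function of class `C^1`. -/
structure Roof (E : Type*) [NormedAddCommGroup E] [NormedSpace ℝ E]
    (M : Type*) [TopologicalSpace M] [ChartedSpace E M] where
  toFun : M → ℝ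
  contMDiff : ContMDiff 𝓘(ℝ, E) 𝓘(ℝ, ℝ) 1 toFun
  pos : ∀ x, 0 < toFun x

instance : CoeFun (Roof E M) fun _ => M → ℝ := ⟨Roof.toFun⟩

/-- The map `(x, s) ↦ (f x, s - ρ x)` of `M × ℝ`, whose powers generate the identifications
`(x, s + ρ x) ∼ (f x, s)`. -/
def deck (f : M ≃ₘ^1⟮𝓘(ℝ, E), 𝓘(ℝ, E)⟯ M) (ρ : Roof E M) : (M × ℝ) ≃ₜ (M × ℝ) where
  toFun p := (f p.1, p.2 - ρ p.1)
  invFun p := (f.symm p.1, p.2 + ρ (f.symm p.1))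
  left_inv p := by simp
  right_inv p := by simp
  continuous_toFun := by
    have h1 := f.continuous
    have h2 := ρ.contMDiff.continuous
    fun_prop
  continuous_invFun := by
    have h1 := f.symm.continuous
    have h2 := ρ.contMDiff.continuous
    fun_prop

variable (f : M ≃ₘ^1⟮𝓘(ℝ, E), 𝓘(ℝ, E)⟯ M) (ρ : Roof E M)

/-- The equivalence relation on `M × ℝ` generated by `(x, s + ρ x) ∼ (f x, s)`. -/
def suspSetoid : Setoid (M × ℝ) where
  r a b := ∃ n : ℤ, (deck f ρ ^ n) a = b
  iseqv :=
    { refl := fun a => ⟨0, by simp⟩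
      symm := by
        rintro a b ⟨n, rfl⟩
        exact ⟨-n, by rw [← Homeomorph.mul_apply, ← zpow_add]; simp⟩
      trans := by
        rintro a b c ⟨n, rfl⟩ ⟨m, rfl⟩
        exact ⟨m + n, by rw [zpow_add, Homeomorph.mul_apply]⟩ }

/-- The suspension manifold `M × ℝ / ∼`. -/
def Susp : Type _ := Quotient (suspSetoid f ρ)

instance suspTopology : TopologicalSpace (Susp f ρ) :=
  inferInstanceAs (TopologicalSpace (Quotient (suspSetoid f ρ)))

/-- The quotient map `M × ℝ → M × ℝ / ∼`. -/
def mk (p : M × ℝ) : Susp f ρ := Quotient.mk (suspSetoid f ρ) p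

variable {f ρ}

theorem deck_apply (p : M × ℝ) : deck f ρ p = (f p.1, p.2 - ρ p.1) := rfl

theorem mk_eq_mk {a b : M × ℝ} : mk f ρ a = mk f ρ b ↔ ∃ n : ℤ, (deck f ρ ^ n) a = b :=
  Quotient.eq (r := suspSetoid f ρ)

theorem mk_surjective : Function.Surjective (mk f ρ) := Quotient.mk_surjective

theorem continuous_mk : Continuous (mk f ρ) := continuous_quotient_mk'

theorem isOpenMap_mk : IsOpenMap (mk f ρ) := by
  intro U hU
  have h : mk f ρ ⁻¹' (mk f ρ '' U) = ⋃ n : ℤ, (deck f ρ ^ n) '' U := by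
    ext b
    simp only [mem_preimage, mem_image, mem_iUnion, mk_eq_mk]
    constructor
    · rintro ⟨a, ha, n, hn⟩; exact ⟨n, a, ha, hn⟩
    · rintro ⟨n, a, ha, hn⟩; exact ⟨a, ha, n, hn⟩
  have h' : IsOpen (mk f ρ ⁻¹' (mk f ρ '' U)) := by
    rw [h]
    exact isOpen_iUnion fun n => (deck f ρ ^ n).isOpenMap U hU
  exact h'

theorem isOpenQuotientMap_mk : IsOpenQuotientMap (mk f ρ) :=
  ⟨mk_surjective, continuous_mk, isOpenMap_mk⟩

theorem deck_pow_snd_le {c : ℝ} (hc : ∀ x, c ≤ ρ x) (p : M × ℝ) (n : ℕ) :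
    ((deck f ρ ^ (n : ℤ)) p).2 ≤ p.2 - n * c := by
  induction n with
  | zero => simp
  | succ n ih =>
    rw [Nat.cast_succ, add_comm, zpow_add, Homeomorph.mul_apply, zpow_one, deck_apply]
    have := hc ((deck f ρ ^ (n : ℤ)) p).1
    push_cast
    linarith

theorem le_deck_neg_pow_snd {c : ℝ} (hc : ∀ x, c ≤ ρ x) (p : M × ℝ) (n : ℕ) :
    p.2 + n * c ≤ ((deck f ρ ^ (-(n : ℤ))) p).2 := by
  have h := deck_pow_snd_le (f := f) hc ((deck f ρ ^ (-(n : ℤ))) p) n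
  rw [← Homeomorph.mul_apply, ← zpow_add] at h
  simp only [add_neg_cancel, zpow_zero, Homeomorph.one_apply] at h
  linarith

theorem abs_le_abs_deck_snd_sub {c : ℝ} (hc : ∀ x, c ≤ ρ x) (p : M × ℝ) (n : ℤ) :
    |(n : ℝ)| * c ≤ |((deck f ρ ^ n) p).2 - p.2| := by
  obtain ⟨m, rfl | rfl⟩ := n.eq_nat_or_neg
  · have h := deck_pow_snd_le (f := f) hc p m
    rw [abs_sub_comm]
    refine le_trans ?_ (le_abs_self _)
    simp only [Int.cast_natCast, Nat.abs_cast]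
    linarith
  · have h := le_deck_neg_pow_snd (f := f) hc p m
    refine le_trans ?_ (le_abs_self _)
    simp only [Int.cast_neg, Int.cast_natCast, abs_neg, Nat.abs_cast]
    linarith

theorem exists_roof_lower_bound [CompactSpace M] (ρ : Roof E M) :
    ∃ c : ℝ, 0 < c ∧ ∀ x, c ≤ ρ x := by
  rcases isEmpty_or_nonempty M with h | h
  · exact ⟨1, one_pos, fun x => (h.false x).elim⟩
  · obtain ⟨x, -, hx⟩ := isCompact_univ.exists_isMinOn (univ_nonempty (α := M))
      ρ.contMDiff.continuous.continuousOn
    exact ⟨ρ x, ρ.pos x, fun y => hx (mem_univ y)⟩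

theorem isLocalHomeomorph_mk [CompactSpace M] : IsLocalHomeomorph (mk f ρ) := by
  obtain ⟨c, hc0, hc⟩ := exists_roof_lower_bound ρ
  rw [isLocalHomeomorph_iff_isOpenEmbedding_restrict]
  intro a
  have hV : IsOpen (univ ×ˢ Ioo (a.2 - c / 2) (a.2 + c / 2) : Set (M × ℝ)) :=
    isOpen_univ.prod isOpen_Ioo
  refine ⟨_, hV.mem_nhds ⟨mem_univ _, by constructor <;> linarith⟩, ?_⟩
  refine .of_continuous_injective_isOpenMap (continuous_mk.comp continuous_subtype_val) ?_
    (isOpenMap_mk.comp hV.isOpenEmbedding_subtypeVal.isOpenMap)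
  rintro ⟨p, _, hp⟩ ⟨p', _, hp'⟩ h
  obtain ⟨n, hn⟩ := mk_eq_mk.1 h
  have h1 := abs_le_abs_deck_snd_sub (f := f) hc p n
  rw [hn] at h1
  have h2 : |p'.2 - p.2| < c := by
    rw [abs_lt]; constructor <;> linarith [hp.1, hp.2, hp'.1, hp'.2]
  have h3 : |(n : ℝ)| < 1 := by
    by_contra h
    push Not at h
    nlinarith
  have h4 : n = 0 := by
    have : |n| < 1 := by exact_mod_cast h3
    exact Int.abs_lt_one_iff.1 this
  subst h4
  exact Subtype.ext (by simpa using hn)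

instance [CompactSpace M] [T2Space M] : T2Space (Susp f ρ) := by
  rw [t2Space_iff_of_isOpenQuotientMap (isOpenQuotientMap_mk (f := f) (ρ := ρ))]
  obtain ⟨c, hc0, hc⟩ := exists_roof_lower_bound ρ
  have h : {q : (M × ℝ) × (M × ℝ) | mk f ρ q.1 = mk f ρ q.2} =
      ⋃ n : ℤ, {q | (deck f ρ ^ n) q.1 = q.2} := by
    ext q; simp [mk_eq_mk]
  rw [h]
  refine LocallyFinite.isClosed_iUnion ?_ fun n =>
    isClosed_eq ((deck f ρ ^ n).continuous.comp continuous_fst) continuous_snd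
  intro q
  set B : ℝ := |q.2.2 - q.1.2| + 1 with hB
  refine ⟨{r | |r.2.2 - r.1.2| < B}, (isOpen_lt (by fun_prop) continuous_const).mem_nhds
    (by simp [hB]), ?_⟩
  refine (Set.finite_Icc (-⌈B / c⌉) ⌈B / c⌉).subset ?_
  rintro n ⟨r, hr1, hr2⟩
  have h1 := abs_le_abs_deck_snd_sub (f := f) hc r.1 n
  rw [show (deck f ρ ^ n) r.1 = r.2 from hr1] at h1
  have h2 : |(n : ℝ)| ≤ B / c := by
    rw [le_div_iff₀ hc0]
    exact h1.trans (le_of_lt hr2)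
  have h3 : |n| ≤ ⌈B / c⌉ := by
    have : (|n| : ℝ) ≤ ⌈B / c⌉ := h2.trans (Int.le_ceil _)
    exact_mod_cast this
  exact abs_le.1 h3

theorem exists_rep [CompactSpace M] (p : Susp f ρ) :
    ∃ a : M × ℝ, (0 ≤ a.2 ∧ a.2 < ρ a.1) ∧ mk f ρ a = p := by
  obtain ⟨b, rfl⟩ := mk_surjective p
  obtain ⟨c, hc0, hc⟩ := exists_roof_lower_bound ρ
  obtain ⟨n, hn, hmax⟩ := Int.exists_greatest_of_bdd
    (P := fun n : ℤ => 0 ≤ ((deck f ρ ^ n) b).2) (by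
      obtain ⟨k, hk⟩ := exists_nat_gt (b.2 / c)
      refine ⟨k, fun z hz => ?_⟩
      by_contra! hlt
      obtain ⟨m, rfl⟩ := Int.eq_ofNat_of_zero_le (by omega : 0 ≤ z)
      have h1 := deck_pow_snd_le (f := f) hc b m
      have h2 : (k : ℝ) < m := by exact_mod_cast hlt
      rw [div_lt_iff₀ hc0] at hk
      nlinarith) (by
      obtain ⟨k, hk⟩ := exists_nat_gt (-b.2 / c)
      refine ⟨-(k : ℤ), ?_⟩
      have h1 := le_deck_neg_pow_snd (f := f) hc b k
      rw [div_lt_iff₀ hc0] at hk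
      linarith)
  refine ⟨(deck f ρ ^ n) b, ⟨hn, ?_⟩, (mk_eq_mk.2 ⟨n, rfl⟩).symm⟩
  by_contra! h
  have h1 : 0 ≤ ((deck f ρ ^ (1 + n)) b).2 := by
    rw [zpow_add, Homeomorph.mul_apply, zpow_one, deck_apply]
    simpa using h
  have := hmax _ h1
  omega

instance [CompactSpace M] : CompactSpace (Susp f ρ) := by
  obtain ⟨C, hC⟩ := (isCompact_range ρ.contMDiff.continuous).bddAbove
  have h : IsCompact (mk f ρ '' (univ ×ˢ Icc (0 : ℝ) C)) :=
    (isCompact_univ.prod isCompact_Icc).image continuous_mk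
  refine ⟨h.of_isClosed_subset isClosed_univ ?_⟩
  rintro p -
  obtain ⟨a, ha, rfl⟩ := exists_rep p
  exact ⟨a, ⟨mem_univ _, ha.1, ha.2.le.trans (hC (mem_range_self _))⟩, rfl⟩

/-! The smooth structure: the charts of the suspension manifold are the local inverses of the
quotient map followed by the charts of `M × ℝ`. -/

instance [CompactSpace M] : ChartedSpace (ModelProd E ℝ) (Susp f ρ) where
  atlas := {c | ∃ (e : OpenPartialHomeomorph (M × ℝ) (Susp f ρ)) (a : M × ℝ),
    ⇑e = mk f ρ ∧ c = e.symm ≫ₕ chartAt (ModelProd E ℝ) a}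
  chartAt p :=
    (isLocalHomeomorph_mk (f := f) (ρ := ρ) (exists_rep p).choose).choose.symm ≫ₕ
      chartAt (ModelProd E ℝ) (exists_rep p).choose
  mem_chart_source p := by
    have ha := (exists_rep p).choose_spec
    have he := (isLocalHomeomorph_mk (f := f) (ρ := ρ) (exists_rep p).choose).choose_spec
    set a := (exists_rep p).choose
    set e := (isLocalHomeomorph_mk (f := f) (ρ := ρ) a).choose
    have h1 : e a = p := by rw [← he.2]; exact ha.2
    have h2 : p ∈ e.target := h1 ▸ e.map_source he.1
    have h3 : e.symm p = a := by rw [← h1]; exact e.left_inv he.1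
    rw [OpenPartialHomeomorph.trans_source]
    refine ⟨h2, ?_⟩
    rw [mem_preimage, h3]
    exact mem_chart_source _ a
  chart_mem_atlas p := ⟨_, _,
    (isLocalHomeomorph_mk (f := f) (ρ := ρ) (exists_rep p).choose).choose_spec.2.symm, rfl⟩

theorem contMDiff_deck_zpow (n : ℤ) :
    ContMDiff (𝓘(ℝ, E).prod 𝓘(ℝ, ℝ)) (𝓘(ℝ, E).prod 𝓘(ℝ, ℝ)) 1 ⇑(deck f ρ ^ n) := by
  have h1 : ContMDiff (𝓘(ℝ, E).prod 𝓘(ℝ, ℝ)) (𝓘(ℝ, E).prod 𝓘(ℝ, ℝ)) 1 ⇑(deck f ρ) :=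
    (f.contMDiff.comp contMDiff_fst).prodMk
      (contMDiff_snd.sub (ρ.contMDiff.comp contMDiff_fst))
  have h2 : ContMDiff (𝓘(ℝ, E).prod 𝓘(ℝ, ℝ)) (𝓘(ℝ, E).prod 𝓘(ℝ, ℝ)) 1 ⇑(deck f ρ)⁻¹ :=
    (f.symm.contMDiff.comp contMDiff_fst).prodMk
      (contMDiff_snd.add (ρ.contMDiff.comp (f.symm.contMDiff.comp contMDiff_fst)))
  induction n with
  | zero => simpa using! contMDiff_id
  | succ n ih => rw [zpow_add, zpow_one]; exact ih.comp h1
  | pred n ih => rw [zpow_sub, zpow_one]; exact ih.comp h2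

instance [CompactSpace M] [IsManifold 𝓘(ℝ, E) 1 M] :
    IsManifold (𝓘(ℝ, E).prod 𝓘(ℝ, ℝ)) 1 (Susp f ρ) := by
  apply isManifold_of_contDiffOn
  rintro _ _ ⟨e, a, he, rfl⟩ ⟨e', a', he', rfl⟩
  set c := chartAt (ModelProd E ℝ) a with hc
  set c' := chartAt (ModelProd E ℝ) a' with hc'
  rintro z ⟨hz, -⟩
  set y : ModelProd E ℝ := (𝓘(ℝ, E).prod 𝓘(ℝ, ℝ)).symm z with hy
  have hzy : (𝓘(ℝ, E).prod 𝓘(ℝ, ℝ)) y = z := by simp [hy]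
  simp only [mem_preimage, OpenPartialHomeomorph.trans_source,
    OpenPartialHomeomorph.symm_source, OpenPartialHomeomorph.coe_trans, Function.comp_apply,
    OpenPartialHomeomorph.trans_symm_eq_symm_trans_symm, OpenPartialHomeomorph.symm_symm,
    mem_inter_iff] at hz
  rw [← hy] at hz
  obtain ⟨⟨hz1, hz2⟩, hz3, hz4⟩ := hz
  set b := c.symm y with hb
  set b' := e'.symm (e b) with hb'
  have hb's : b' ∈ e'.source := e'.map_target hz3
  have hbb : mk f ρ b = mk f ρ b' := by
    have h1 : e' b' = e b := e'.right_inv hz3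
    rw [he, he'] at h1
    exact h1.symm
  obtain ⟨n, hn⟩ := mk_eq_mk.1 hbb
  have hev : (fun x => e'.symm (e x)) =ᶠ[𝓝 b] ⇑(deck f ρ ^ n) := by
    have : ⇑(deck f ρ ^ n) ⁻¹' e'.source ∈ 𝓝 b :=
      (deck f ρ ^ n).continuous.continuousAt.preimage_mem_nhds
        (by rw [hn]; exact e'.open_source.mem_nhds hb's)
    filter_upwards [this] with x hx
    have h1 : e x = e' ((deck f ρ ^ n) x) := by
      rw [he, he']; exact mk_eq_mk.2 ⟨n, rfl⟩
    rw [h1]; exact e'.left_inv hx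
  have hg : ContMDiffAt (𝓘(ℝ, E).prod 𝓘(ℝ, ℝ)) (𝓘(ℝ, E).prod 𝓘(ℝ, ℝ)) 1
      (fun x => e'.symm (e x)) b :=
    (contMDiff_deck_zpow n).contMDiffAt.congr_of_eventuallyEq hev
  have hT : ContMDiffAt (𝓘(ℝ, E).prod 𝓘(ℝ, ℝ)) (𝓘(ℝ, E).prod 𝓘(ℝ, ℝ)) 1
      (fun u => c' (e'.symm (e (c.symm u)))) y :=
    ContMDiffAt.comp (g := c') y
      (contMDiffAt_of_mem_maximalAtlas (IsManifold.chart_mem_maximalAtlas a') hz4)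
      (ContMDiffAt.comp (g := fun x => e'.symm (e x)) (f := c.symm) y hg
        (contMDiffAt_symm_of_mem_maximalAtlas (IsManifold.chart_mem_maximalAtlas a) hz1))
  have := (contMDiffAt_iff.1 hT).2
  simp only [mfld_simps] at this
  have hzy' : y = z := hzy
  rw [hzy'] at this
  exact this.mono (fun _ _ => by simp)

/-- The quotient map is of class `C^1`. -/
theorem contMDiff_mk [CompactSpace M] [IsManifold 𝓘(ℝ, E) 1 M] :
    ContMDiff (𝓘(ℝ, E).prod 𝓘(ℝ, ℝ)) (𝓘(ℝ, E).prod 𝓘(ℝ, ℝ)) 1 (mk f ρ) := by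
  intro b
  obtain ⟨e, a, he, hch⟩ := chart_mem_atlas (ModelProd E ℝ) (mk f ρ b)
  have hmem := mem_chart_source (ModelProd E ℝ) (mk f ρ b)
  rw [contMDiffAt_iff_target]
  refine ⟨continuous_mk.continuousAt, ?_⟩
  rw [hch, OpenPartialHomeomorph.trans_source] at hmem
  obtain ⟨h1, h2⟩ := hmem
  have h1' : mk f ρ b ∈ e.target := h1
  have hb' : e.symm (mk f ρ b) ∈ e.source := e.map_target h1'
  have h3 : mk f ρ b = mk f ρ (e.symm (mk f ρ b)) := by
    rw [← he]; exact (e.right_inv (he ▸ h1')).symm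
  obtain ⟨n, hn⟩ := mk_eq_mk.1 h3
  have hev : (fun x => e.symm (mk f ρ x)) =ᶠ[𝓝 b] ⇑(deck f ρ ^ n) := by
    have : ⇑(deck f ρ ^ n) ⁻¹' e.source ∈ 𝓝 b :=
      (deck f ρ ^ n).continuous.continuousAt.preimage_mem_nhds
        (by rw [hn]; exact e.open_source.mem_nhds hb')
    filter_upwards [this] with x hx
    have h1 : mk f ρ x = e ((deck f ρ ^ n) x) := by
      rw [he]; exact mk_eq_mk.2 ⟨n, rfl⟩
    rw [h1]; exact e.left_inv hx
  have hg : ContMDiffAt (𝓘(ℝ, E).prod 𝓘(ℝ, ℝ)) (𝓘(ℝ, E).prod 𝓘(ℝ, ℝ)) 1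
      (fun x => e.symm (mk f ρ x)) b :=
    (contMDiff_deck_zpow n).contMDiffAt.congr_of_eventuallyEq hev
  have hT : ContMDiffAt (𝓘(ℝ, E).prod 𝓘(ℝ, ℝ)) (𝓘(ℝ, E).prod 𝓘(ℝ, ℝ)) 1
      (fun u => chartAt (ModelProd E ℝ) a (e.symm (mk f ρ u))) b :=
    ContMDiffAt.comp (g := chartAt (ModelProd E ℝ) a) b
      (contMDiffAt_of_mem_maximalAtlas (IsManifold.chart_mem_maximalAtlas a) h2) hg
  have hx : (extChartAt (𝓘(ℝ, E).prod 𝓘(ℝ, ℝ)) (mk f ρ b)) ∘ mk f ρ =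
      fun u => (chartAt (ModelProd E ℝ) a (e.symm (mk f ρ u)) : E × ℝ) := by
    funext u
    simp [extChartAt, hch]
    rfl
  rw [hx]
  have := (contMDiffAt_iff_target.1 hT).2
  simp only [mfld_simps] at this
  exact this

instance [CompactSpace M] [T2Space M] [FiniteDimensional ℝ E] :
    TopologicalSpace.MetrizableSpace (Susp f ρ) := by
  have : SecondCountableTopology (ModelProd E ℝ) :=
    inferInstanceAs (SecondCountableTopology (E × ℝ))
  have : SecondCountableTopology (Susp f ρ) :=
    ChartedSpace.secondCountable_of_sigmaCompact (ModelProd E ℝ) _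
  infer_instance

/-! ### The suspension flow, singular suspensions and the set `A_Sing` -/

/-- The vertical translation `(x, s) ↦ (x, s + t)` of `M × ℝ`. -/
def vertical (M : Type*) [TopologicalSpace M] (t : ℝ) : (M × ℝ) ≃ₜ (M × ℝ) :=
  (Homeomorph.refl M).prodCongr (Homeomorph.addRight t)

theorem vertical_apply (t : ℝ) (p : M × ℝ) : vertical M t p = (p.1, p.2 + t) := rfl

theorem deck_zpow_vertical (n : ℤ) (t : ℝ) (p : M × ℝ) :
    (deck f ρ ^ n) (vertical M t p) = vertical M t ((deck f ρ ^ n) p) := by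
  have h : Commute (deck f ρ) (vertical M t) := by
    ext q <;> simp [Homeomorph.mul_apply, deck_apply, vertical_apply]
    ring
  exact congrArg (fun g : (M × ℝ) ≃ₜ (M × ℝ) => g p) (h.zpow_left n)

variable (f ρ)

/-- The suspension flow of `f` with roof `ρ`, induced by the vertical flow
`(t, (x, s)) ↦ (x, s + t)`. -/
def suspFlow : Flow ℝ (Susp f ρ) where
  toFun t := Quotient.map (vertical M t) (by
    rintro a b ⟨n, rfl⟩
    exact ⟨n, deck_zpow_vertical n t a⟩)
  cont' := by
    have h : IsOpenQuotientMap (Prod.map id (mk f ρ) : ℝ × (M × ℝ) → ℝ × Susp f ρ) :=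
      IsOpenQuotientMap.id.prodMap isOpenQuotientMap_mk
    exact h.isQuotientMap.continuous_iff.2 (continuous_mk.comp
      (f := fun q : ℝ × (M × ℝ) => (q.2.1, q.2.2 + q.1)) (by fun_prop))
  map_add' t₁ t₂ p := by
    obtain ⟨a, rfl⟩ := mk_surjective p
    change mk f ρ _ = mk f ρ _
    simp only [vertical_apply]
    congr 2
    ring
  map_zero' p := by
    obtain ⟨a, rfl⟩ := mk_surjective p
    change mk f ρ _ = mk f ρ _
    simp [vertical_apply]

theorem suspFlow_mk (t : ℝ) (x : M) (s : ℝ) :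
    suspFlow f ρ t (mk f ρ (x, s)) = mk f ρ (x, s + t) := rfl

variable {f ρ}

/-- The orbits of the suspension flow are of class `C^1`; in particular they have velocities. -/
theorem contMDiff_suspFlow_orbit [CompactSpace M] [IsManifold 𝓘(ℝ, E) 1 M] (p : Susp f ρ) :
    ContMDiff 𝓘(ℝ, ℝ) (𝓘(ℝ, E).prod 𝓘(ℝ, ℝ)) 1 (fun t : ℝ => suspFlow f ρ t p) := by
  obtain ⟨⟨x, s⟩, rfl⟩ := mk_surjective p
  exact contMDiff_mk.comp (contMDiff_const.prodMk (contMDiff_const.add contMDiff_id))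

/-- The velocity field of a flow on the suspension manifold: at `p`, the derivative at `t = 0` of
`t ↦ φ_t(p)`. -/
def velocity [CompactSpace M] (φ : Flow ℝ (Susp f ρ)) (p : Susp f ρ) :
    TangentSpace (𝓘(ℝ, E).prod 𝓘(ℝ, ℝ)) p :=
  mfderiv 𝓘(ℝ, ℝ) (𝓘(ℝ, E).prod 𝓘(ℝ, ℝ)) (fun t : ℝ => φ t p) 0 (1 : ℝ)

/-- A brake: a non-negative function of class `C^1` on the suspension manifold. -/
structure IsBrake [CompactSpace M] (α : Susp f ρ → ℝ) : Prop where
  contMDiff : ContMDiff (𝓘(ℝ, E).prod 𝓘(ℝ, ℝ)) 𝓘(ℝ, ℝ) 1 α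
  nonneg : ∀ p, 0 ≤ α p

/-- `ψ` is the singular suspension of `f` with roof `ρ` and brake `α`: the flow on the suspension
manifold induced by the vector field `α X_φ`, where `X_φ` is the velocity field of the suspension
flow `φ`. -/
structure IsSingularSuspension [CompactSpace M] (α : Susp f ρ → ℝ) (ψ : Flow ℝ (Susp f ρ)) :
    Prop where
  brake : IsBrake α
  isMIntegralCurve : ∀ p, IsMIntegralCurve (I := 𝓘(ℝ, E).prod 𝓘(ℝ, ℝ)) (fun t : ℝ => ψ t p)
    (fun q => α q • velocity (suspFlow f ρ) q)

/-- The natural projection of the suspension manifold onto `M`: each point has exactly one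
representative `(x, s)` in the fundamental domain `0 ≤ s < ρ x`, and is sent to `x`. -/
def proj [CompactSpace M] (p : Susp f ρ) : M := (exists_rep p).choose.1

theorem rep_unique {a b : M × ℝ} (ha : 0 ≤ a.2 ∧ a.2 < ρ a.1) (hb : 0 ≤ b.2 ∧ b.2 < ρ b.1)
    (h : mk f ρ a = mk f ρ b) : a = b := by
  have key : ∀ (n : ℕ) (q : M × ℝ), q.2 < ρ q.1 → ((deck f ρ ^ ((n + 1 : ℕ) : ℤ)) q).2 < 0 := by
    intro n q hq
    rw [Nat.cast_succ, zpow_add, Homeomorph.mul_apply, zpow_one]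
    have := deck_pow_snd_le (f := f) (fun x => (ρ.pos x).le) (deck f ρ q) n
    simp only [deck_apply] at this ⊢
    linarith
  obtain ⟨n, hn⟩ := mk_eq_mk.1 h
  obtain ⟨m, rfl | rfl⟩ := n.eq_nat_or_neg
  · rcases m with _ | m
    · simpa using hn
    · have := key m a ha.2
      rw [hn] at this
      linarith [hb.1]
  · rcases m with _ | m
    · simpa using hn
    · have := key m b hb.2
      rw [← hn, ← Homeomorph.mul_apply, ← zpow_add] at this
      simp only [add_neg_cancel, zpow_zero, Homeomorph.one_apply] at this
      linarith [ha.1]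

theorem proj_mk [CompactSpace M] {a : M × ℝ} (ha : 0 ≤ a.2 ∧ a.2 < ρ a.1) :
    proj (mk f ρ a) = a.1 :=
  congrArg Prod.fst (rep_unique (exists_rep (mk f ρ a)).choose_spec.1 ha
    (exists_rep (mk f ρ a)).choose_spec.2)

/-- `A_Sing`: the projection to `M` of the union of the `φ`-orbits of the points of
`S = {α = 0}`, the set of singularities of the singular suspension with brake `α`; here `φ` is the
suspension flow. -/
def singShadow [CompactSpace M] (α : Susp f ρ → ℝ) : Set M :=
  proj '' (⋃ t : ℝ, suspFlow f ρ t '' {p | α p = 0})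

end SingularSuspension

end

/-!
Let `K` be the support of `μ`. It is compact and `f`-invariant, and since it misses `A_Sing` the
brake `α` is positive on the compact part of the suspension that lies over `K`. There the singular
suspension `ψ` is a time change of the suspension flow with speed bounded below:
`ψ_t p = φ_{s(t)} p` with `s(t) = ∫₀ᵗ α(ψ_r p) dr` (`IsSingularSuspension.eq_suspFlow`). This needs no uniqueness
theorem for integral curves: in the charts of the suspension `X_φ` is a constant vector field, so
`φ_{-s(t)} ψ_t p` is locally constant in `t`.

Such a time change may alter the entropy, but it preserves its positivity, for the following
reason. Suppose that the `ψ`-orbits of `[x, 0]` and `[y, 0]`, with `x, y ∈ K`, stay close up to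
time `T`. Lift both to `M × ℝ`. Heights that differ by at most half the least roof in fact differ
by little (`exists_close_of_mk_close`), so the lifted orbits cross each roof almost
simultaneously, and at each crossing `f^j x` and `f^j y` are close. As the speed is bounded below,
the number of crossings grows linearly with `T`. Hence orbits of `f` in `K` are separated in time
`m` only if the corresponding orbits of `ψ_1` are separated in time `J m`, for a constant `J`
(`exists_iterate_close_of_disjoint_singShadow`).

It remains to bound the metric entropy of `f` by the growth of separated sets for `ψ_1`. Let `P`
be a finite partition. Off a set `B` of small measure `P` is constant on close points
(`exists_isOpen_diag_eq_of_mem`), so a maximal separated set `S` of `ψ_1` on the section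
determines, for each point of `K`, its `P`-itinerary outside the visits to `B`, up to the choice
of an element of `S`. Gibbs' inequality, applied to a mixture over `S` of product measures
concentrated near these itineraries, bounds the entropy of the `m`-th join by `log |S|` plus an
arbitrarily small multiple of `m` (`joinEntropy_le_log_card`). Since the error per step is
arbitrarily small, there is no need to pass to powers of `f`, nor for an ergodic theorem.
-/

namespace SingularSuspension

open Set Filter MeasureTheory

/-! ### Entropy and the number of codes -/

/-- Gibbs' inequality. -/
theorem sum_negMulLog_le_sum_mul_neg_log {ι : Type*} [Fintype ι] {p q : ι → ℝ}
    (hp : ∀ i, 0 ≤ p i) (hp1 : ∑ i, p i = 1) (hq : ∀ i, 0 < q i) (hq1 : ∑ i, q i ≤ 1) :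
    ∑ i, Real.negMulLog (p i) ≤ ∑ i, p i * -Real.log (q i) := by
  have h : ∀ i, Real.negMulLog (p i) ≤ p i * -Real.log (q i) + (q i - p i) := by
    intro i
    rcases (hp i).eq_or_lt with h0 | h0
    · simp [← h0, (hq i).le]
    · have h1 := Real.log_le_sub_one_of_pos (div_pos (hq i) h0)
      rw [Real.log_div (hq i).ne' h0.ne'] at h1
      have h2 := mul_le_mul_of_nonneg_left h1 h0.le
      have h3 : p i * (q i / p i - 1) = q i - p i := by field_simp
      rw [h3] at h2
      rw [Real.negMulLog]
      linarith
  have h' := Finset.sum_le_sum fun i (_ : i ∈ Finset.univ) => h i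
  rw [Finset.sum_add_distrib, Finset.sum_sub_distrib] at h'
  linarith

/-- The weights on `Fin k` that give the letter `a` mass `1 - θ` and every other letter mass `θ /
k`; the total mass may fall short of `1`. -/
noncomputable def noisyWeight {k : ℕ} (θ : ℝ) (a b : Fin k) : ℝ := if b = a then 1 - θ else θ / k

theorem noisyWeight_pos {k : ℕ} {θ : ℝ} (h0 : 0 < θ) (h1 : θ < 1) (a b : Fin k) :
    0 < noisyWeight θ a b := by
  unfold noisyWeight
  have : 0 < k := a.pos
  split_ifs
  · linarith
  · positivity

theorem sum_noisyWeight_le {k : ℕ} {θ : ℝ} (h0 : 0 < θ) (a : Fin k) :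
    ∑ b, noisyWeight θ a b ≤ 1 := by
  have hk : (0 : ℝ) < k := by exact_mod_cast a.pos
  have h : ∀ b, noisyWeight θ a b ≤ (if b = a then 1 - θ else 0) + θ / k := by
    intro b
    have : 0 < θ / k := by positivity
    unfold noisyWeight
    split_ifs <;> linarith
  refine (Finset.sum_le_sum fun b _ => h b).trans ?_
  rw [Finset.sum_add_distrib]
  simp only [Finset.sum_ite_eq', Finset.mem_univ, if_true, Finset.sum_const, Finset.card_univ,
    Fintype.card_fin, nsmul_eq_mul]
  rw [mul_div_cancel₀ _ hk.ne']
  linarith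

/-- If, outside a small exceptional set `B`, the `P`-itinerary of length `m` of almost every point
can be read off from one of the words `code e`, `e ∈ E`, then the entropy of the `m`-th join is at
most `log |E|` plus an error proportional to `m`. The error per step is as small as desired: take
`θ` small first and then `μ B`. -/
theorem joinEntropy_le_log_card {X : Type*} [MeasurableSpace X] {T : X → X} {μ : Measure X}
    [IsProbabilityMeasure μ] (hT : MeasurePreserving T μ μ) {k : ℕ} {P : X → Fin k}
    (hP : Measurable P) {B : Set X} (hB : MeasurableSet B) {θ : ℝ} (h0 : 0 < θ) (h1 : θ < 1)
    (m : ℕ) {ι : Type*} [Fintype ι] (code : ι → Fin m → Fin k)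
    (h : ∀ᵐ x ∂μ, ∃ e, ∀ i : Fin m, T^[i] x ∉ B → P (T^[i] x) = code e i) :
    joinEntropy T μ P m ≤
      Real.log (Fintype.card ι) + m * (-Real.log (1 - θ) + μ.real B * Real.log (k / θ)) := by
  obtain ⟨x₀, e₀, -⟩ := h.exists
  have hι : 0 < Fintype.card ι := Fintype.card_pos_iff.2 ⟨e₀⟩
  have hN : (0 : ℝ) < Fintype.card ι := by exact_mod_cast hι
  have hk : (1 : ℝ) ≤ k := by exact_mod_cast (P x₀).pos
  have hk0 : (0 : ℝ) < k := by linarith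
  have hne : Nonempty ι := ⟨e₀⟩
  set word : X → Fin m → Fin k := fun x i => P (T^[i] x) with hword
  have hTi : ∀ i : ℕ, Measurable T^[i] := fun i => hT.measurable.iterate i
  have hwm : Measurable word := measurable_pi_lambda _ fun i => hP.comp (hTi i)
  -- A mixture, over the available codes, of product measures concentrated near the code.
  set q : (Fin m → Fin k) → ℝ := fun w =>
    (Fintype.card ι : ℝ)⁻¹ * ∑ e, ∏ i, noisyWeight θ (code e i) (w i) with hq
  have hpp : ∀ (e : ι) (w : Fin m → Fin k), 0 < ∏ i, noisyWeight θ (code e i) (w i) :=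
    fun e w => Finset.prod_pos fun i _ => noisyWeight_pos h0 h1 _ _
  have hq0 : ∀ w, 0 < q w := fun w =>
    mul_pos (inv_pos.2 hN) (Finset.sum_pos (fun e _ => hpp e w) Finset.univ_nonempty)
  have hq1 : ∑ w, q w ≤ 1 := by
    rw [hq, ← Finset.mul_sum, Finset.sum_comm, inv_mul_le_iff₀ hN, mul_one]
    refine (Finset.sum_le_sum (g := fun _ => (1 : ℝ)) fun e _ => ?_).trans (by simp)
    rw [← Fintype.prod_sum fun i b => noisyWeight θ (code e i) b]
    exact Finset.prod_le_one (fun i _ => Finset.sum_nonneg fun b _ =>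
      (noisyWeight_pos h0 h1 _ _).le) fun i _ => sum_noisyWeight_le h0 _
  set ν : Measure (Fin m → Fin k) := μ.map word with hν
  have hνp : IsProbabilityMeasure ν := Measure.isProbabilityMeasure_map hwm.aemeasurable
  have hpw : ∀ w, μ.real {x | ∀ i : Fin m, P (T^[i] x) = w i} = ν.real {w} := by
    intro w
    rw [hν, map_measureReal_apply hwm (measurableSet_singleton w)]
    congr 1
    ext x
    simp [hword, funext_iff]
  have hstep : joinEntropy T μ P m ≤ ∫ x, -Real.log (q (word x)) ∂μ := by
    have hI : ∫ x, -Real.log (q (word x)) ∂μ = ∑ w, ν.real {w} * -Real.log (q w) := by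
      rw [← integral_map (f := fun w => -Real.log (q w)) hwm.aemeasurable
        (measurable_of_finite _).aestronglyMeasurable, integral_fintype .of_finite]
      simp [hν]
    rw [hI, joinEntropy]
    simp only [hpw]
    refine sum_negMulLog_le_sum_mul_neg_log (fun _ => measureReal_nonneg) ?_ hq0 hq1
    simp
  have hlogk : 0 ≤ Real.log (k / θ) := Real.log_nonneg (by rw [le_div_iff₀ h0]; linarith)
  have hlog1 : Real.log (1 - θ) ≤ 0 := Real.log_nonpos (by linarith) (by linarith)
  have hterm : ∀ᵐ x ∂μ, -Real.log (q (word x)) ≤ Real.log (Fintype.card ι) +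
      ∑ i : Fin m, (-Real.log (1 - θ) +
        (T^[i] ⁻¹' B).indicator (fun _ => Real.log (k / θ)) x) := by
    filter_upwards [h] with x ⟨e, he⟩
    have hle : (Fintype.card ι : ℝ)⁻¹ * ∏ i, noisyWeight θ (code e i) (word x i) ≤ q (word x) := by
      refine mul_le_mul_of_nonneg_left ?_ (inv_nonneg.2 hN.le)
      exact Finset.single_le_sum (f := fun e => ∏ i, noisyWeight θ (code e i) (word x i))
        (fun e _ => (hpp e _).le) (Finset.mem_univ e)
    have hlog := Real.log_le_log (mul_pos (inv_pos.2 hN) (hpp e _)) hle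
    rw [Real.log_mul (inv_pos.2 hN).ne' (hpp e _).ne', Real.log_inv,
      Real.log_prod fun i _ => (noisyWeight_pos h0 h1 _ _).ne'] at hlog
    have hi : ∀ i : Fin m, -Real.log (noisyWeight θ (code e i) (word x i)) ≤
        -Real.log (1 - θ) + (T^[i] ⁻¹' B).indicator (fun _ => Real.log (k / θ)) x := by
      intro i
      by_cases hx : T^[i] x ∈ B
      · rw [indicator_of_mem (by exact hx)]
        unfold noisyWeight
        split_ifs
        · linarith
        · rw [← Real.log_inv, inv_div]; linarith
      · rw [indicator_of_notMem (by exact hx), hword]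
        simp only [noisyWeight, he i hx, if_true, add_zero, le_refl]
    have hs := Finset.sum_le_sum fun i (_ : i ∈ Finset.univ) => hi i
    rw [Finset.sum_neg_distrib] at hs
    linarith
  have hind : ∀ i : Fin m, Integrable
      ((T^[i] ⁻¹' B).indicator (fun _ => Real.log (k / θ))) μ :=
    fun i => (integrable_const _).indicator (hTi i hB)
  have hi2 : ∀ i : Fin m, Integrable (fun x => -Real.log (1 - θ) +
        (T^[i] ⁻¹' B).indicator (fun _ => Real.log (k / θ)) x) μ :=
    fun i => (integrable_const _).add (hind i)
  refine hstep.trans ((integral_mono_ae ?_ ?_ hterm).trans (le_of_eq ?_))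
  · exact (Integrable.of_finite (μ := ν) (f := fun w => -Real.log (q w))).comp_measurable hwm
  · exact (integrable_const _).add (integrable_finsetSum _ fun i _ => hi2 i)
  · rw [integral_add (integrable_const _) (integrable_finsetSum _ fun i _ => hi2 i),
      integral_finsetSum _ fun i _ => hi2 i]
    have : ∀ i : Fin m, ∫ x, (-Real.log (1 - θ) +
        (T^[i] ⁻¹' B).indicator (fun _ => Real.log (k / θ)) x) ∂μ =
        -Real.log (1 - θ) + μ.real B * Real.log (k / θ) := by
      intro i
      rw [integral_add (integrable_const _) (hind i), integral_indicator_const _ (hTi i hB),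
        (hT.iterate i).measureReal_preimage hB.nullMeasurableSet]
      simp
    simp [this]
    ring

section Suspension

variable {E : Type*} [NormedAddCommGroup E] [NormedSpace ℝ E]
  {M : Type*} [TopologicalSpace M] [ChartedSpace E M]
  {f : M ≃ₘ^1⟮𝓘(ℝ, E), 𝓘(ℝ, E)⟯ M} {ρ : Roof E M}

/-! ### A singular suspension is a time change of the suspension flow -/

/-- The velocity of a curve, read in the chart at an arbitrary nearby point. -/
theorem hasDerivAt_extChartAt_comp {F : Type*} [NormedAddCommGroup F] [NormedSpace ℝ F]
    {H : Type*} [TopologicalSpace H] {I : ModelWithCorners ℝ F H} [I.Boundaryless]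
    {N : Type*} [TopologicalSpace N] [ChartedSpace H N] [IsManifold I 1 N] {γ : ℝ → N} {t : ℝ}
    (hγ : MDifferentiableAt 𝓘(ℝ, ℝ) I γ t)
    {p p₀ : N} (hp : γ t = p) (hp₀ : p ∈ (extChartAt I p₀).source) :
    HasDerivAt (extChartAt I p₀ ∘ γ)
      (tangentCoordChange I p p₀ p (mfderiv 𝓘(ℝ, ℝ) I γ t (1 : ℝ))) t := by
  subst hp
  -- `A` is the derivative of `γ`, with the tangent spaces replaced by their model spaces.
  obtain ⟨A, hA⟩ : ∃ A : ℝ →L[ℝ] F, A = mfderiv 𝓘(ℝ, ℝ) I γ t := ⟨_, rfl⟩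
  have h1 : HasFDerivAt (extChartAt I (γ t) ∘ γ) A t := by
    have h := hγ.hasMFDerivAt.2
    rw [← hA] at h
    rw [← hasFDerivWithinAt_univ]
    simpa only [mfld_simps] using! h
  have h2 : HasDerivAt (extChartAt I (γ t) ∘ γ) (A 1) t := h1.hasDerivAt
  have h3 := hasFDerivWithinAt_tangentCoordChange (I := I) (x := γ t) (y := p₀) (z := γ t)
    ⟨mem_extChartAt_source _, hp₀⟩
  rw [I.range_eq_univ, hasFDerivWithinAt_univ] at h3
  rw [← hA]
  refine (h3.comp_hasDerivAt t h2).congr_of_eventuallyEq ?_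
  filter_upwards [hγ.continuousAt.eventually_mem
    (extChartAt_source_mem_nhds (I := I) (γ t))] with r hr
  exact congrArg (extChartAt I p₀) ((extChartAt I (γ t)).left_inv hr).symm

/-- In the preferred charts of the suspension manifold the suspension flow is the translation of the
last coordinate. -/
theorem eventually_extChartAt_suspFlow [CompactSpace M] (p₀ : Susp f ρ) :
    ∀ᶠ z : Susp f ρ × ℝ in 𝓝 (p₀, 0),
      extChartAt (𝓘(ℝ, E).prod 𝓘(ℝ, ℝ)) p₀ (suspFlow f ρ z.2 z.1) =
        extChartAt (𝓘(ℝ, E).prod 𝓘(ℝ, ℝ)) p₀ z.1 + ((0 : E), z.2) := by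
  obtain ⟨e, a, he, hch⟩ := chart_mem_atlas (ModelProd E ℝ) p₀
  have hmem := mem_chart_source (ModelProd E ℝ) p₀
  rw [hch, OpenPartialHomeomorph.trans_source] at hmem
  have h1 : p₀ ∈ e.target := hmem.1
  have hx : ∀ p, extChartAt (𝓘(ℝ, E).prod 𝓘(ℝ, ℝ)) p₀ p =
      (chartAt E a.1 (e.symm p).1, (e.symm p).2) := by
    intro p
    simp [extChartAt, hch]
    rfl
  have hs : ContinuousAt (fun z : Susp f ρ × ℝ => e.symm z.1) (p₀, 0) :=
    (e.continuousAt_symm h1).comp continuousAt_fst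
  have hs' : ContinuousAt (fun z : Susp f ρ × ℝ => ((e.symm z.1).1, (e.symm z.1).2 + z.2))
      (p₀, 0) := hs.fst.prodMk (hs.snd.add continuousAt_snd)
  have h2 : ∀ᶠ z : Susp f ρ × ℝ in 𝓝 (p₀, 0), z.1 ∈ e.target :=
    continuousAt_fst.eventually_mem (e.open_target.mem_nhds h1)
  have h3 : ∀ᶠ z : Susp f ρ × ℝ in 𝓝 (p₀, 0),
      ((e.symm z.1).1, (e.symm z.1).2 + z.2) ∈ e.source :=
    hs'.eventually_mem (e.open_source.mem_nhds (by simpa using e.map_target h1))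
  filter_upwards [h2, h3] with z hz2 hz3
  have h4 : e.symm (suspFlow f ρ z.2 z.1) = ((e.symm z.1).1, (e.symm z.1).2 + z.2) := by
    conv_lhs => rw [← e.right_inv hz2, he]
    rw [suspFlow_mk, ← he, e.left_inv hz3]
  rw [hx, hx, h4]
  simp

/-- In the preferred charts, the velocity field of the suspension flow is the last unit vector. -/
theorem eventually_tangentCoordChange_smul_velocity [CompactSpace M] [IsManifold 𝓘(ℝ, E) 1 M]
    (p₀ : Susp f ρ) :
    ∀ᶠ p in 𝓝 p₀, ∀ c : ℝ, tangentCoordChange (𝓘(ℝ, E).prod 𝓘(ℝ, ℝ)) p p₀ p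
      (c • velocity (suspFlow f ρ) p) = ((0 : E), c) := by
  filter_upwards [(eventually_extChartAt_suspFlow p₀).curry_nhds,
    extChartAt_source_mem_nhds (I := 𝓘(ℝ, E).prod 𝓘(ℝ, ℝ)) p₀] with p hp hps c
  have h1 := hasDerivAt_extChartAt_comp (t := (0 : ℝ))
    ((contMDiff_suspFlow_orbit p).mdifferentiable one_ne_zero 0) (Flow.map_zero_apply _ _) hps
  have h2 : HasDerivAt (extChartAt (𝓘(ℝ, E).prod 𝓘(ℝ, ℝ)) p₀ ∘ fun t : ℝ => suspFlow f ρ t p)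
      ((0 : E), (1 : ℝ)) 0 := by
    refine HasDerivAt.congr_of_eventuallyEq ?_ hp
    simpa using! ((hasDerivAt_const (0 : ℝ) (0 : E)).prodMk (hasDerivAt_id (0 : ℝ))).const_add
      (extChartAt (𝓘(ℝ, E).prod 𝓘(ℝ, ℝ)) p₀ p)
  have h3 : tangentCoordChange (𝓘(ℝ, E).prod 𝓘(ℝ, ℝ)) p p₀ p (velocity (suspFlow f ρ) p) =
      ((0 : E), (1 : ℝ)) := h1.unique h2
  refine ((tangentCoordChange (𝓘(ℝ, E).prod 𝓘(ℝ, ℝ)) p p₀ p).map_smul c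
    (velocity (suspFlow f ρ) p)).trans ?_
  rw [h3]
  simp

/-- Flow lines of a singular suspension are locally flow lines of the suspension flow. -/
theorem IsSingularSuspension.eventually_eq_suspFlow [CompactSpace M] [IsManifold 𝓘(ℝ, E) 1 M]
    {α : Susp f ρ → ℝ} {ψ : Flow ℝ (Susp f ρ)} (hψ : IsSingularSuspension α ψ) (p : Susp f ρ)
    (t₀ : ℝ) :
    ∀ᶠ t in 𝓝 t₀, ψ t p = suspFlow f ρ (∫ r in t₀..t, α (ψ r p)) (ψ t₀ p) := by
  set I := 𝓘(ℝ, E).prod 𝓘(ℝ, ℝ) with hI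
  set p₀ := ψ t₀ p with hp₀
  have hα : Continuous fun r => α (ψ r p) :=
    hψ.brake.contMDiff.continuous.comp (ψ.continuous continuous_id continuous_const)
  have hc : Continuous fun t => ψ t p := ψ.continuous continuous_id continuous_const
  have hσ : ∀ t, HasDerivAt (fun t => ∫ r in t₀..t, α (ψ r p)) (α (ψ t p)) t := fun t =>
    intervalIntegral.integral_hasDerivAt_right (hα.intervalIntegrable _ _)
      (hα.stronglyMeasurableAtFilter _ _) hα.continuousAt
  have h1 := ((hψ.isMIntegralCurve p).isMIntegralCurveAt t₀).eventually_hasDerivAt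
  have h2 := hc.continuousAt.eventually (eventually_tangentCoordChange_smul_velocity (ψ t₀ p))
  have h3 : ∀ᶠ t in 𝓝 t₀, HasDerivAt (fun t => extChartAt I p₀ (ψ t p) -
      ((0 : E), ∫ r in t₀..t, α (ψ r p))) 0 t := by
    filter_upwards [h1, h2] with t ht1 ht2
    rw [ht2] at ht1
    have := ht1.sub ((hasDerivAt_const t (0 : E)).prodMk (hσ t))
    rw [sub_self] at this
    exact this
  obtain ⟨δ, hδ, hball⟩ := Metric.eventually_nhds_iff_ball.1 h3
  have h4 : ∀ t ∈ Metric.ball t₀ δ, extChartAt I p₀ (ψ t p) -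
      ((0 : E), ∫ r in t₀..t, α (ψ r p)) = extChartAt I p₀ p₀ := by
    intro t ht
    have := (convex_ball t₀ δ).is_const_of_fderivWithin_eq_zero (𝕜 := ℝ)
      (f := fun t => extChartAt I p₀ (ψ t p) - ((0 : E), ∫ r in t₀..t, α (ψ r p)))
      (fun t ht => (hball t ht).differentiableAt.differentiableWithinAt) (fun t ht => by
        rw [fderivWithin_of_isOpen Metric.isOpen_ball ht]
        have := (hball t ht).hasFDerivAt.fderiv
        simpa using this) ht (Metric.mem_ball_self hδ)
    rw [this]
    simp [hp₀]
  have hσc : ContinuousAt (fun t => (p₀, ∫ r in t₀..t, α (ψ r p))) t₀ :=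
    continuousAt_const.prodMk (hσ t₀).continuousAt
  have h5 : ∀ᶠ t in 𝓝 t₀, extChartAt I p₀ (suspFlow f ρ (∫ r in t₀..t, α (ψ r p)) p₀) =
      extChartAt I p₀ p₀ + ((0 : E), ∫ r in t₀..t, α (ψ r p)) :=
    hσc.eventually (by simpa using! eventually_extChartAt_suspFlow p₀)
  have h6 : ∀ᶠ t in 𝓝 t₀, ψ t p ∈ (extChartAt I p₀).source :=
    hc.continuousAt.eventually_mem (extChartAt_source_mem_nhds (I := I) _)
  have h7 : ∀ᶠ t in 𝓝 t₀,
      suspFlow f ρ (∫ r in t₀..t, α (ψ r p)) p₀ ∈ (extChartAt I p₀).source := by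
    have : ContinuousAt (fun t => suspFlow f ρ (∫ r in t₀..t, α (ψ r p)) p₀) t₀ :=
      ((suspFlow f ρ).continuous continuous_id continuous_const).continuousAt.comp
        (hσ t₀).continuousAt
    refine this.eventually_mem ?_
    simpa using extChartAt_source_mem_nhds (I := I) p₀
  filter_upwards [Metric.ball_mem_nhds t₀ hδ, h5, h6, h7] with t ht1 ht5 ht6 ht7
  refine (extChartAt I p₀).injOn ht6 ht7 ?_
  rw [ht5, ← h4 t ht1]
  simp

/-- The singular suspension is the time change of the suspension flow by the integral of the brake
along its own orbits. -/
theorem IsSingularSuspension.eq_suspFlow [CompactSpace M] [IsManifold 𝓘(ℝ, E) 1 M]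
    {α : Susp f ρ → ℝ} {ψ : Flow ℝ (Susp f ρ)} (hψ : IsSingularSuspension α ψ) (p : Susp f ρ)
    (t : ℝ) :
    ψ t p = suspFlow f ρ (∫ r in (0 : ℝ)..t, α (ψ r p)) p := by
  have hα : Continuous fun r => α (ψ r p) :=
    hψ.brake.contMDiff.continuous.comp (ψ.continuous continuous_id continuous_const)
  -- Undoing the time change gives a locally constant curve.
  have hloc : IsLocallyConstant
      fun t => suspFlow f ρ (-∫ r in (0 : ℝ)..t, α (ψ r p)) (ψ t p) := by
    rw [IsLocallyConstant.iff_eventually_eq]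
    intro t₀
    filter_upwards [hψ.eventually_eq_suspFlow p t₀] with t ht
    rw [ht, ← Flow.map_add]
    congr 1
    have := intervalIntegral.integral_add_adjacent_intervals
      (hα.intervalIntegrable (μ := volume) 0 t₀) (hα.intervalIntegrable t₀ t)
    linarith
  have h := hloc.apply_eq_of_preconnectedSpace t 0
  simp only [intervalIntegral.integral_same, neg_zero, Flow.map_zero_apply] at h
  rw [← h, ← Flow.map_add]
  simp [h]

/-! ### Orbits over a compact invariant set that avoids the singularities -/

theorem mk_sub_birkhoffSum (x : M) (u : ℝ) (n : ℕ) :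
    mk f ρ (f^[n] x, u - birkhoffSum f ρ n x) = mk f ρ (x, u) := by
  induction n with
  | zero => simp
  | succ n ih =>
    rw [← ih, eq_comm, mk_eq_mk]
    refine ⟨1, ?_⟩
    rw [zpow_one, deck_apply, birkhoffSum_succ, Function.iterate_succ_apply', sub_sub]

/-- The forward flow lines that start over a forward invariant set `K` stay over the part of `K` in
a bounded region of `M × ℝ`. -/
theorem exists_rep_mem_Icc_of_mapsTo {K : Set M} (hK : MapsTo f K K) {c C : ℝ} (hc0 : 0 < c)
    (hc : ∀ x, c ≤ ρ x) (hC : ∀ x, ρ x ≤ C) {x : M} (hx : x ∈ K) {u : ℝ} (hu : 0 ≤ u) :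
    ∃ a ∈ K ×ˢ Icc 0 C, mk f ρ a = mk f ρ (x, u) := by
  obtain ⟨n, hn⟩ := exists_nat_gt (u / c)
  rw [div_lt_iff₀ hc0] at hn
  induction n generalizing x u with
  | zero => simp at hn; linarith
  | succ n ih =>
    rcases le_or_gt u C with h | h
    · exact ⟨(x, u), ⟨hx, hu, h⟩, rfl⟩
    · push_cast at hn
      have h1 := hC x
      have h2 := hc x
      obtain ⟨a, ha, h'⟩ := ih (hK hx) (u := u - ρ x) (by linarith) (by linarith)
      refine ⟨a, ha, h'.trans ?_⟩
      simpa using mk_sub_birkhoffSum (f := f) (ρ := ρ) x u 1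

theorem pos_of_notMem_singShadow [CompactSpace M] {α : Susp f ρ → ℝ} (hα : ∀ p, 0 ≤ α p)
    {x : M} (hx : x ∉ singShadow α) (u : ℝ) : 0 < α (mk f ρ (x, u)) := by
  refine (hα _).lt_of_ne fun h => hx ?_
  refine ⟨mk f ρ (x, 0), mem_iUnion.2 ⟨-u, mk f ρ (x, u), h.symm, ?_⟩, ?_⟩
  · rw [suspFlow_mk, add_neg_cancel]
  · exact proj_mk ⟨le_rfl, ρ.pos x⟩

/-- Over a compact forward invariant set disjoint from the shadow of the singularities, the orbits
of the singular suspension lift to vertical lines of `M × ℝ` that are run through with speed at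
least `δ`. -/
theorem exists_lift_of_disjoint_singShadow [CompactSpace M] [IsManifold 𝓘(ℝ, E) 1 M]
    {α : Susp f ρ → ℝ} {ψ : Flow ℝ (Susp f ρ)} (hψ : IsSingularSuspension α ψ) {K : Set M}
    (hKc : IsCompact K) (hK : MapsTo f K K) (hKα : Disjoint K (singShadow α)) :
    ∃ δ > 0, ∀ x ∈ K, ∃ s : ℝ → ℝ, Continuous s ∧ Monotone s ∧ s 0 = 0 ∧
      (∀ t, 0 ≤ t → δ * t ≤ s t) ∧ ∀ t, ψ t (mk f ρ (x, 0)) = mk f ρ (x, s t) := by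
  obtain ⟨c, hc0, hc⟩ := exists_roof_lower_bound ρ
  obtain ⟨C, hC⟩ := (isCompact_range ρ.contMDiff.continuous).bddAbove
  have hC' : ∀ x, ρ x ≤ C := fun x => hC (mem_range_self x)
  obtain ⟨δ, hδ, hδα⟩ := ((hKc.prod isCompact_Icc).image (continuous_mk (f := f) (ρ := ρ)) :
    IsCompact (mk f ρ '' (K ×ˢ Icc 0 C))).exists_forall_le' (a := 0)
      hψ.brake.contMDiff.continuous.continuousOn (by
        rintro _ ⟨⟨x, u⟩, ⟨hx, -⟩, rfl⟩
        exact pos_of_notMem_singShadow hψ.brake.nonneg (disjoint_left.1 hKα hx) u)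
  refine ⟨δ, hδ, fun x hx => ?_⟩
  set p := mk f ρ (x, 0) with hp
  have hα : Continuous fun r => α (ψ r p) :=
    hψ.brake.contMDiff.continuous.comp (ψ.continuous continuous_id continuous_const)
  have hint : ∀ a b, IntervalIntegrable (fun r => α (ψ r p)) volume a b :=
    fun a b => hα.intervalIntegrable a b
  have hs : ∀ t, ψ t p = mk f ρ (x, ∫ r in (0 : ℝ)..t, α (ψ r p)) := by
    intro t
    rw [hψ.eq_suspFlow p t]
    simp only [hp, suspFlow_mk, zero_add]
  refine ⟨fun t => ∫ r in (0 : ℝ)..t, α (ψ r p), ?_, ?_, by simp, ?_, hs⟩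
  · exact intervalIntegral.continuous_primitive hint 0
  · intro a b hab
    have h1 := intervalIntegral.integral_add_adjacent_intervals (hint 0 a) (hint a b)
    have h2 : 0 ≤ ∫ r in a..b, α (ψ r p) :=
      intervalIntegral.integral_nonneg hab fun r _ => hψ.brake.nonneg _
    simp only
    linarith
  · intro t ht
    have h : ∫ _ in (0 : ℝ)..t, δ ≤ ∫ r in (0 : ℝ)..t, α (ψ r p) := by
      refine intervalIntegral.integral_mono_on ht (by simp) (hint 0 t) fun r hr => hδα _ ?_
      rw [hs r]
      obtain ⟨a, ha, h⟩ := exists_rep_mem_Icc_of_mapsTo hK hc0 hc hC' hx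
        (intervalIntegral.integral_nonneg hr.1 fun r _ => hψ.brake.nonneg (ψ r p))
      exact ⟨a, ha, h⟩
    simpa [mul_comm] using h

/-! ### Orbits of the singular suspension shadow orbits of the diffeomorphism -/

/-- Two points of `M × ℝ` whose heights differ by less than the least roof are close as soon as
their images in the suspension manifold are. The metric of the suspension manifold enters through
its distance function `D` alone, because its topology is only propositionally equal to the
quotient topology. -/
theorem exists_close_of_mk_close [CompactSpace M] [T2Space M] {D : Susp f ρ → Susp f ρ → ℝ}
    (hD : Continuous fun z : Susp f ρ × Susp f ρ => D z.1 z.2) (hD0 : ∀ p q, D p q ≤ 0 ↔ p = q)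
    {V : Set (M × M)} (hV : IsOpen V) (hdiag : ∀ x, (x, x) ∈ V) {c : ℝ} (hc0 : 0 < c)
    (hc : ∀ x, c ≤ ρ x) (C : ℝ) {η : ℝ} (hη : 0 < η) :
    ∃ ε > 0, ∀ x y u v, u ∈ Icc 0 C → |u - v| ≤ c / 2 → D (mk f ρ (x, u)) (mk f ρ (y, v)) < ε →
      (x, y) ∈ V ∧ |u - v| < η := by
  set Z : Set ((M × ℝ) × (M × ℝ)) := {z | z.1.2 ∈ Icc 0 C ∧ |z.1.2 - z.2.2| ≤ c / 2 ∧
    ¬((z.1.1, z.2.1) ∈ V ∧ |z.1.2 - z.2.2| < η)} with hZ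
  have hZc : IsCompact Z := by
    refine ((isCompact_univ.prod (isCompact_Icc (a := 0) (b := C))).prod
      (isCompact_univ.prod (isCompact_Icc (a := -(c / 2)) (b := C + c / 2)))).of_isClosed_subset
      ?_ ?_
    · have hd : Continuous fun z : (M × ℝ) × (M × ℝ) => |z.1.2 - z.2.2| := by fun_prop
      have hO : IsOpen {z : (M × ℝ) × (M × ℝ) | (z.1.1, z.2.1) ∈ V ∧ |z.1.2 - z.2.2| < η} :=
        (hV.preimage (by fun_prop)).inter (isOpen_lt hd continuous_const)
      exact (isClosed_Icc.preimage (continuous_snd.comp continuous_fst)).inter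
        ((isClosed_le hd continuous_const).inter hO.isClosed_compl)
    · rintro ⟨⟨x, u⟩, ⟨y, v⟩⟩ ⟨h1, h2, -⟩
      simp only [mem_Icc] at h1 h2
      rw [abs_le] at h2
      exact ⟨⟨mem_univ _, h1⟩, mem_univ _, by constructor <;> simp only <;> linarith⟩
  obtain ⟨ε, hε, h⟩ := hZc.exists_forall_le' (a := 0)
    (f := fun z : (M × ℝ) × (M × ℝ) => D (mk f ρ z.1) (mk f ρ z.2))
    (hD.comp ((continuous_mk.comp continuous_fst).prodMk
      (continuous_mk.comp continuous_snd))).continuousOn (by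
      rintro ⟨a, b⟩ ⟨-, h2, h3⟩
      by_contra! hle
      obtain ⟨n, hn⟩ := mk_eq_mk.1 ((hD0 _ _).1 hle)
      have h4 := abs_le_abs_deck_snd_sub (f := f) hc a n
      rw [hn, abs_sub_comm] at h4
      have h5 : |(n : ℝ)| < 1 := by
        by_contra! h
        simp only at h2
        nlinarith
      have h6 : n = 0 := Int.abs_lt_one_iff.1 (by exact_mod_cast h5)
      subst h6
      obtain rfl : a = b := by simpa using hn
      exact h3 ⟨hdiag _, by simpa using hη⟩)
  refine ⟨ε, hε, fun x y u v hu huv hlt => ?_⟩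
  by_contra hcon
  exact absurd hlt (not_lt.2 (h ((x, u), (y, v)) ⟨hu, huv, hcon⟩))

/-- If two lifted orbits stay close in the suspension manifold up to a time by which the first has
climbed above `m` roofs, then they cross the first `m` roofs almost simultaneously, and at close
points of `M`. The constant `ε` is one provided by `exists_close_of_mk_close`. -/
theorem iterate_close_of_lift_close {V : Set (M × M)} {c C ε : ℝ} (hc0 : 0 < c)
    (hC : ∀ x, ρ x ≤ C) (hVρ : ∀ z ∈ V, |ρ z.1 - ρ z.2| < c / 4) {D : Susp f ρ → Susp f ρ → ℝ}
    (hε : ∀ x y u v, u ∈ Icc 0 C → |u - v| ≤ c / 2 → D (mk f ρ (x, u)) (mk f ρ (y, v)) < ε →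
      (x, y) ∈ V ∧ |u - v| < c / 4) {x y : M} {s s' : ℝ → ℝ} (hs : Continuous s)
    (hsm : Monotone s) (hs0 : s 0 = 0) (hs' : Continuous s') (hs0' : s' 0 = 0) {T : ℝ}
    (hT : 0 ≤ T) (hclose : ∀ t ∈ Icc 0 T, D (mk f ρ (x, s t)) (mk f ρ (y, s' t)) < ε) {m : ℕ}
    (hm : C * m ≤ s T) : ∀ j < m, (f^[j] x, f^[j] y) ∈ V := by
  set R : ℕ → M → ℝ := fun j x => birkhoffSum f ρ j x with hR
  have hRs : ∀ j x, R (j + 1) x = R j x + ρ (f^[j] x) := fun j x => birkhoffSum_succ f ρ j x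
  have hRC : ∀ j, R j x ≤ C * j := by
    intro j
    induction j with
    | zero => simp [hR]
    | succ j ih => rw [hRs]; push_cast; linarith [hC (f^[j] x)]
  have hC0 : 0 ≤ C := (ρ.pos x).le.trans (hC x)
  have key : ∀ j < m, (∃ t ∈ Icc 0 T, s t = R j x ∧ |s' t - R j y| < c / 2) →
      (f^[j] x, f^[j] y) ∈ V ∧
        ∃ t ∈ Icc 0 T, s t = R (j + 1) x ∧ |s' t - R (j + 1) y| < c / 2 := by
    rintro j hj ⟨t₀, ht₀, h1, h2⟩
    have hjm : C * ((j + 1 : ℕ) : ℝ) ≤ C * m :=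
      mul_le_mul_of_nonneg_left (by exact_mod_cast hj) hC0
    have hle : R j x ≤ R (j + 1) x := by rw [hRs]; linarith [ρ.pos (f^[j] x)]
    obtain ⟨t₁, ht₁, h3⟩ := intermediate_value_Icc ht₀.2 hs.continuousOn
      (show R (j + 1) x ∈ Icc (s t₀) (s T) from
        ⟨h1.trans_le hle, (hRC (j + 1)).trans (hjm.trans hm)⟩)
    -- Between two consecutive crossings a height difference of at most `c / 2` is at most `c / 4`.
    have hup : ∀ t ∈ Icc t₀ t₁, |(s t - R j x) - (s' t - R j y)| ≤ c / 2 →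
        (f^[j] x, f^[j] y) ∈ V ∧ |(s t - R j x) - (s' t - R j y)| < c / 4 := by
      intro t ht hle
      refine hε _ _ _ _ ⟨?_, ?_⟩ hle ?_
      · linarith [hsm ht.1]
      · have := hsm ht.2
        rw [h3, hRs] at this
        linarith [hC (f^[j] x)]
      · rw [mk_sub_birkhoffSum, mk_sub_birkhoffSum]
        exact hclose t ⟨ht₀.1.trans ht.1, ht.2.trans ht₁.2⟩
    have hst : |(s t₀ - R j x) - (s' t₀ - R j y)| < c / 2 := by
      rw [h1, sub_self, zero_sub, abs_neg]; exact h2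
    have hend : |(s t₁ - R j x) - (s' t₁ - R j y)| ≤ c / 2 := by
      by_contra! hgt
      obtain ⟨t, ht, h⟩ := intermediate_value_Icc ht₁.1
        (f := fun t => |(s t - R j x) - (s' t - R j y)|) (by fun_prop) ⟨hst.le, hgt.le⟩
      have := (hup t ht h.le).2
      simp only at h
      linarith
    obtain ⟨hVj, h4⟩ := hup t₁ (right_mem_Icc.2 ht₁.1) hend
    refine ⟨hVj, t₁, ⟨ht₀.1.trans ht₁.1, ht₁.2⟩, h3, ?_⟩
    have h5 := hVρ _ hVj
    rw [h3, hRs] at h4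
    rw [hRs]
    simp only [abs_lt] at h4 h5 ⊢
    constructor <;> linarith
  have hind : ∀ j ≤ m, ∃ t ∈ Icc 0 T, s t = R j x ∧ |s' t - R j y| < c / 2 := by
    intro j
    induction j with
    | zero => exact fun _ => ⟨0, ⟨le_rfl, hT⟩, by simp [hR, hs0], by simp [hR, hs0', hc0]⟩
    | succ j ih => exact fun hj => (key j hj (ih (Nat.le_of_succ_le hj))).2
  exact fun j hj => (key j hj (hind j hj.le)).1

/-- Points that are close stay close under a flow during a unit of time. -/
theorem exists_close_of_le_one {X : Type*} [TopologicalSpace X] [CompactSpace X]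
    (ψ : Flow ℝ X) {D : X → X → ℝ} (hD : Continuous fun z : X × X => D z.1 z.2)
    (hD0 : ∀ p q, D p q ≤ 0 ↔ p = q) {ε : ℝ} (hε : 0 < ε) :
    ∃ ε' > 0, ∀ p q, D p q < ε' → ∀ r ∈ Icc (0 : ℝ) 1, D (ψ r p) (ψ r q) < ε := by
  have hc : Continuous fun z : ℝ × X × X => D (ψ z.1 z.2.1) (ψ z.1 z.2.2) :=
    hD.comp ((ψ.continuous continuous_fst (continuous_fst.comp continuous_snd)).prodMk
      (ψ.continuous continuous_fst (continuous_snd.comp continuous_snd)))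
  have hZ : IsCompact (Icc (0 : ℝ) 1 ×ˢ univ ∩
      {z : ℝ × X × X | ε ≤ D (ψ z.1 z.2.1) (ψ z.1 z.2.2)}) :=
    (isCompact_Icc.prod isCompact_univ).inter_right (isClosed_le continuous_const hc)
  obtain ⟨ε', hε', h⟩ := hZ.exists_forall_le' (a := 0) (f := fun z => D z.2.1 z.2.2)
    (hD.comp continuous_snd).continuousOn (by
      rintro ⟨r, p, q⟩ ⟨-, hz⟩
      by_contra! hle
      obtain rfl : p = q := (hD0 _ _).1 hle
      exact absurd ((hD0 (ψ r p) (ψ r p)).2 rfl) (not_le.2 (hε.trans_le hz)))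
  refine ⟨ε', hε', fun p q hpq r hr => ?_⟩
  by_contra! hle
  exact absurd hpq (not_lt.2 (h (r, p, q) ⟨⟨hr, mem_univ _⟩, hle⟩))

theorem iterate_flow_one {X : Type*} [TopologicalSpace X] (ψ : Flow ℝ X) (k : ℕ) (p : X) :
    (ψ 1)^[k] p = ψ k p := by
  induction k with
  | zero => simp
  | succ k ih => rw [Function.iterate_succ_apply', ih, ← Flow.map_add]; push_cast; rw [add_comm]

/-- Two orbits of the time-one map of the singular suspension that start on the section `s = 0` and
stay close during `J m` steps come from points of `M` whose first `m` iterates are close. -/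
theorem exists_iterate_close_of_disjoint_singShadow [CompactSpace M] [T2Space M]
    [IsManifold 𝓘(ℝ, E) 1 M] {α : Susp f ρ → ℝ} {ψ : Flow ℝ (Susp f ρ)}
    (hψ : IsSingularSuspension α ψ) {K : Set M} (hKc : IsCompact K) (hK : MapsTo f K K)
    (hKα : Disjoint K (singShadow α)) {D : Susp f ρ → Susp f ρ → ℝ}
    (hD : Continuous fun z : Susp f ρ × Susp f ρ => D z.1 z.2) (hD0 : ∀ p q, D p q ≤ 0 ↔ p = q)
    {V : Set (M × M)} (hV : IsOpen V) (hdiag : ∀ x, (x, x) ∈ V) :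
    ∃ ε > 0, ∃ J : ℕ, 0 < J ∧ ∀ m : ℕ, ∀ x ∈ K, ∀ y ∈ K,
      (∀ k ≤ J * m, D ((ψ 1)^[k] (mk f ρ (x, 0))) ((ψ 1)^[k] (mk f ρ (y, 0))) < ε) →
        ∀ j < m, (f^[j] x, f^[j] y) ∈ V := by
  obtain ⟨c, hc0, hc⟩ := exists_roof_lower_bound ρ
  obtain ⟨C, hC⟩ := (isCompact_range ρ.contMDiff.continuous).bddAbove
  have hC' : ∀ x, ρ x ≤ C := fun x => hC (mem_range_self x)
  have hρ : Continuous ρ := ρ.contMDiff.continuous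
  obtain ⟨δ, hδ, hlift⟩ := exists_lift_of_disjoint_singShadow hψ hKc hK hKα
  set V' : Set (M × M) := V ∩ {z | |ρ z.1 - ρ z.2| < c / 4} with hV'
  have hV'o : IsOpen V' := hV.inter (isOpen_lt (by fun_prop) continuous_const)
  obtain ⟨ε₁, hε₁, h₁⟩ := exists_close_of_mk_close hD hD0 hV'o
    (fun x => ⟨hdiag x, by simp [hc0]⟩) hc0 hc C (η := c / 4) (by linarith)
  obtain ⟨ε, hε, h₂⟩ := exists_close_of_le_one ψ hD hD0 hε₁
  obtain ⟨J, hJ⟩ := exists_nat_gt (max 0 (C / δ))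
  rw [max_lt_iff, div_lt_iff₀ hδ] at hJ
  refine ⟨ε, hε, J, by exact_mod_cast hJ.1, fun m x hx y hy h => ?_⟩
  obtain ⟨s, hs, hsm, hs0, hsδ, hsψ⟩ := hlift x hx
  obtain ⟨s', hs', -, hs0', -, hsψ'⟩ := hlift y hy
  have hT : (0 : ℝ) ≤ (J * m : ℕ) := Nat.cast_nonneg _
  have := iterate_close_of_lift_close (T := (J * m : ℕ)) (m := m) hc0 hC' (fun z hz => hz.2) h₁ hs
    hsm hs0 hs' hs0' hT (fun t ht => by
      have hk : ⌊t⌋₊ ≤ J * m := by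
        have := Nat.floor_le_floor ht.2
        rwa [Nat.floor_natCast] at this
      have ht' := h₂ _ _ (h _ hk) (t - ⌊t⌋₊)
        ⟨sub_nonneg.2 (Nat.floor_le ht.1), by linarith [Nat.lt_floor_add_one t]⟩
      rw [iterate_flow_one, iterate_flow_one, ← Flow.map_add, ← Flow.map_add,
        sub_add_cancel, hsψ, hsψ'] at ht'
      exact ht') (by
      refine le_trans ?_ (hsδ _ hT)
      push_cast
      nlinarith [hJ.2, (Nat.cast_nonneg m : (0 : ℝ) ≤ m)])
  exact fun j hj => (this j hj).1

end Suspension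

/-! ### Positive entropy from shadowing -/

/-- A measurable finite-valued map is, off a set of small measure, constant on close points:
closeness is expressed by a neighbourhood of the diagonal, so no metric is involved. -/
theorem exists_isOpen_diag_eq_of_mem {Y : Type*} [TopologicalSpace Y]
    [TopologicalSpace.PseudoMetrizableSpace Y] [MeasurableSpace Y] [BorelSpace Y] (μ : Measure Y)
    [IsFiniteMeasure μ] {k : ℕ} {P : Y → Fin k} (hP : Measurable P) {η : ℝ} (hη : 0 < η) :
    ∃ V : Set (Y × Y), IsOpen V ∧ (∀ x, (x, x) ∈ V) ∧ ∃ B : Set Y, MeasurableSet B ∧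
      μ.real B ≤ η ∧ ∀ x y, x ∉ B → y ∉ B → (x, y) ∈ V → P x = P y := by
  rcases Nat.eq_zero_or_pos k with rfl | hk
  · exact ⟨univ, isOpen_univ, fun _ => mem_univ _, ∅, .empty, by simpa using hη.le,
      fun x => (P x).elim0⟩
  have hk' : (0 : ℝ) < k := by exact_mod_cast hk
  have hm : ∀ i, MeasurableSet (P ⁻¹' {i}) := fun i => hP (measurableSet_singleton i)
  have h : ∀ i, ∃ F ⊆ P ⁻¹' {i}, IsClosed F ∧ μ (P ⁻¹' {i} \ F) < ENNReal.ofReal (η / k) :=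
    fun i => (hm i).exists_isClosed_sdiff_lt (measure_ne_top μ _)
      (ENNReal.ofReal_pos.2 (by positivity)).ne'
  choose F hFP hFc hFμ using h
  refine ⟨(⋃ z : Fin k × Fin k, ⋃ _ : z.1 ≠ z.2, F z.1 ×ˢ F z.2)ᶜ, ?_, ?_,
    ⋃ i, P ⁻¹' {i} \ F i, ?_, ?_, ?_⟩
  · exact (isClosed_iUnion_of_finite fun z : Fin k × Fin k => isClosed_iUnion_of_finite fun _ =>
      (hFc z.1).prod (hFc z.2)).isOpen_compl
  · intro x hx
    simp only [mem_iUnion] at hx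
    obtain ⟨z, hz, h1, h2⟩ := hx
    exact hz ((hFP _ h1).symm.trans (hFP _ h2))
  · exact .iUnion fun i => (hm i).diff (hFc i).measurableSet
  · refine (measureReal_iUnion_fintype_le _).trans
      ((Finset.sum_le_sum (g := fun _ => η / k) fun i _ => ?_).trans (le_of_eq ?_))
    · exact ENNReal.toReal_le_of_le_ofReal (by positivity) (hFμ i).le
    · simp; field_simp
  · intro x y hx hy hxy
    by_contra hne
    simp only [mem_iUnion, Set.mem_sdiff, mem_preimage, mem_singleton_iff, not_exists, not_and,
      not_not] at hx hy
    refine hxy (mem_iUnion₂.2 ⟨(P x, P y), hne, hx _ rfl, hy _ rfl⟩)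

/-- A maximal separated subset of a set `A` spans `A`. -/
theorem exists_separated_spanning {X : Type*} [MetricSpace X] (T : X → X) (n : ℕ) {ε : ℝ}
    (hε : 0 ≤ ε) (hfin : maxSeparatedCard T n ε ≠ ⊤) (A : Set X) :
    ∃ K : Finset X, ↑K ⊆ A ∧ (K.card : ℕ∞) ≤ maxSeparatedCard T n ε ∧
      ∀ x ∈ A, ∃ e ∈ K, ∀ k ≤ n, dist (T^[k] x) (T^[k] e) ≤ ε := by
  classical
  have hle : ∀ K : Finset X, IsSeparatedFor T n ε (K : Set X) →
      (K.card : ℕ∞) ≤ maxSeparatedCard T n ε := fun K hK =>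
    le_iSup₂ (f := fun (K : Finset X) (_ : IsSeparatedFor T n ε (K : Set X)) => (K.card : ℕ∞)) K hK
  by_contra! hcon
  -- Otherwise every separated subset of `A` can be enlarged, and there are arbitrarily large ones.
  have hbig : ∀ m : ℕ, ∃ K : Finset X, ↑K ⊆ A ∧ IsSeparatedFor T n ε (K : Set X) ∧ K.card = m := by
    intro m
    induction m with
    | zero => exact ⟨∅, by simp, by simp [IsSeparatedFor], rfl⟩
    | succ m ih =>
      obtain ⟨K, hKA, hK, rfl⟩ := ih
      obtain ⟨x, hxA, hx⟩ := hcon K hKA (hle K hK)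
      have hxK : x ∉ K := fun hmem => by
        obtain ⟨k, -, hk⟩ := hx x hmem
        rw [dist_self] at hk
        linarith
      refine ⟨insert x K, ?_, ?_, Finset.card_insert_of_notMem hxK⟩
      · rw [Finset.coe_insert]; exact insert_subset hxA hKA
      · rw [Finset.coe_insert]
        rintro a (rfl | ha) b (rfl | hb) hab
        · exact absurd rfl hab
        · exact hx b hb
        · obtain ⟨k, hk, h⟩ := hx a ha
          exact ⟨k, hk, by rwa [dist_comm]⟩
        · exact hK a ha b hb hab
  refine hfin (ENat.eq_top_iff_forall_ge.2 fun m => ?_)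
  obtain ⟨K, -, hK, rfl⟩ := hbig m
  exact hle K hK

/-- If the closeness of two `T`-orbits along `J m` steps forces the closeness of two `f`-orbits
along `m` steps, then positive metric entropy of `f` gives positive topological entropy of `T`. -/
theorem topEntropy_pos_of_shadowing {X : Type*} [MetricSpace X] {T : X → X} {Y : Type*}
    [TopologicalSpace Y] [TopologicalSpace.PseudoMetrizableSpace Y] [MeasurableSpace Y]
    [BorelSpace Y] {f : Y → Y} {μ : Measure Y} [IsProbabilityMeasure μ]
    (hf : MeasurePreserving f μ μ) (hent : 0 < metricEntropy f μ) {K : Set Y} (hK : ∀ᵐ x ∂μ, x ∈ K)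
    (σ : Y → X)
    (hσ : ∀ V : Set (Y × Y), IsOpen V → (∀ x, (x, x) ∈ V) → ∃ ε > 0, ∃ J : ℕ, 0 < J ∧
      ∀ m : ℕ, ∀ x ∈ K, ∀ y ∈ K, (∀ k ≤ J * m, dist (T^[k] (σ x)) (T^[k] (σ y)) < ε) →
        ∀ j < m, (f^[j] x, f^[j] y) ∈ V) :
    0 < topEntropy T := by
  simp only [metricEntropy, lt_iSup_iff] at hent
  obtain ⟨k, P, hP, hent⟩ := hent
  obtain ⟨h, h0, hh⟩ := EReal.lt_iff_exists_real_btwn.1 hent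
  replace h0 : 0 < h := by exact_mod_cast h0
  have hfreq := frequently_lt_of_lt_limsup (by isBoundedDefault) hh
  -- The error per step of the entropy estimate is made at most `h / 2`.
  set θ : ℝ := 1 - Real.exp (-(h / 4)) with hθ
  have hexp : Real.exp (-(h / 4)) < 1 := by
    rw [← Real.exp_zero]; exact Real.exp_lt_exp.2 (by linarith)
  have hθ0 : 0 < θ := by linarith
  have hθ1 : θ < 1 := by linarith [Real.exp_pos (-(h / 4))]
  have hlog : -Real.log (1 - θ) = h / 4 := by rw [hθ, sub_sub_cancel, Real.log_exp, neg_neg]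
  set L : ℝ := Real.log (k / θ) with hL
  have hL0 : 0 < |L| + 1 := by positivity
  obtain ⟨V, hV, hdiag, B, hB, hBη, hVB⟩ := exists_isOpen_diag_eq_of_mem μ hP
    (η := h / 4 / (|L| + 1)) (by positivity)
  have hBL : μ.real B * L ≤ h / 4 := calc
    μ.real B * L ≤ h / 4 / (|L| + 1) * (|L| + 1) :=
      (mul_le_mul_of_nonneg_left ((le_abs_self L).trans (by linarith)) measureReal_nonneg).trans
        (mul_le_mul_of_nonneg_right hBη hL0.le)
    _ = h / 4 := div_mul_cancel₀ _ hL0.ne'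
  obtain ⟨ε, hε, J, hJ, hclose⟩ := hσ V hV hdiag
  have hmain : ∀ m : ℕ, 0 < m → h < joinEntropy f μ P m / m →
      ((h / (2 * J) : ℝ) : EReal) ≤
        ENNReal.log (maxSeparatedCard T (J * m) (ε / 3) : ENNReal) / ((J * m : ℕ) : EReal) := by
    intro m hm hhm
    have hm' : (0 : ℝ) < m := by exact_mod_cast hm
    have hJ' : (0 : ℝ) < J := by exact_mod_cast hJ
    rw [EReal.le_div_iff_mul_le (by exact_mod_cast Nat.mul_pos hJ hm) (EReal.natCast_ne_top _)]
    by_cases hfin : maxSeparatedCard T (J * m) (ε / 3) = ⊤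
    · simp [hfin]
    obtain ⟨S, hSσ, hScard, hS⟩ := exists_separated_spanning T (J * m) (ε := ε / 3)
      (by positivity) hfin (σ '' K)
    -- The points of `K` near a given `e` have the same letter at all times outside `B`.
    have hcode : ∀ (e : S) (i : Fin m), ∃ a : Fin k, ∀ x ∈ K,
        (∀ l ≤ J * m, dist (T^[l] (σ x)) (T^[l] e) ≤ ε / 3) → f^[i] x ∉ B → P (f^[i] x) = a := by
      intro e i
      by_cases hex : ∃ x ∈ K, (∀ l ≤ J * m, dist (T^[l] (σ x)) (T^[l] e) ≤ ε / 3) ∧ f^[i] x ∉ B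
      · obtain ⟨y, hy, hye, hyB⟩ := hex
        refine ⟨P (f^[i] y), fun x hx hxe hxB => hVB _ _ hxB hyB ?_⟩
        refine hclose m x hx y hy (fun l hl => ?_) i i.2
        have := dist_triangle_right (T^[l] (σ x)) (T^[l] (σ y)) (T^[l] e)
        linarith [hxe l hl, hye l hl]
      · push Not at hex
        obtain ⟨x₀, -⟩ := hK.exists
        exact ⟨P x₀, fun x hx hxe hxB => absurd (hex x hx hxe) hxB⟩
    choose code hcode using hcode
    have hspan : ∀ x ∈ K, ∃ e : S, ∀ l ≤ J * m, dist (T^[l] (σ x)) (T^[l] e) ≤ ε / 3 := by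
      intro x hx
      obtain ⟨e, he, h⟩ := hS _ (mem_image_of_mem σ hx)
      exact ⟨⟨e, he⟩, h⟩
    have hle := joinEntropy_le_log_card hf hP hB hθ0 hθ1 m code (by
      filter_upwards [hK] with x hx
      obtain ⟨e, he⟩ := hspan x hx
      exact ⟨e, fun i hi => hcode e i x hx he hi⟩)
    rw [hlog, Fintype.card_coe] at hle
    rw [lt_div_iff₀ hm'] at hhm
    have hlogS : h / (2 * J) * (J * m : ℕ) ≤ Real.log S.card := by
      have h1 : h / (2 * J) * (J * m : ℕ) = h / 2 * m := by push_cast; field_simp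
      rw [h1]
      nlinarith
    have hSpos : 0 < S.card := by
      obtain ⟨x, hx⟩ := hK.exists
      obtain ⟨e, -⟩ := hspan x hx
      exact Finset.card_pos.2 ⟨e, e.2⟩
    calc ((h / (2 * J) : ℝ) : EReal) * ((J * m : ℕ) : EReal)
        = ((h / (2 * J) * (J * m : ℕ) : ℝ) : EReal) := by push_cast; rfl
      _ ≤ (Real.log S.card : EReal) := by exact_mod_cast hlogS
      _ = ENNReal.log (S.card : ENNReal) := by
        rw [← ENNReal.ofReal_natCast, ENNReal.log_ofReal_of_pos (by exact_mod_cast hSpos)]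
      _ ≤ _ := ENNReal.log_monotone (by exact_mod_cast hScard)
  have hlim : ((h / (2 * J) : ℝ) : EReal) ≤ limsup (fun n : ℕ =>
      ENNReal.log (maxSeparatedCard T n (ε / 3) : ENNReal) / (n : EReal)) atTop := by
    refine le_limsup_of_frequently_le ?_ (by isBoundedDefault)
    refine Tendsto.frequently (Filter.tendsto_id.const_mul_atTop' hJ) ?_
    refine (hfreq.and_eventually (eventually_gt_atTop 0)).mono fun m hm => ?_
    exact hmain m hm.2 (by exact_mod_cast hm.1)
  have hpos : (0 : EReal) < ((h / (2 * J) : ℝ) : EReal) := by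
    have : 0 < h / (2 * J) := by positivity
    exact_mod_cast this
  exact hpos.trans_le (hlim.trans (le_iSup₂ (f := fun (ε : ℝ) (_ : 0 < ε) => limsup (fun n : ℕ =>
      ENNReal.log (maxSeparatedCard T n ε : ENNReal) / (n : EReal)) atTop) (ε / 3) (by positivity)))

theorem mapsTo_support {Y : Type*} [TopologicalSpace Y] [MeasurableSpace Y] [OpensMeasurableSpace Y]
    {f : Y → Y} (hfc : Continuous f) {μ : Measure Y} (hf : MeasurePreserving f μ μ) :
    MapsTo f μ.support μ.support := by
  intro x hx
  rw [Measure.mem_support_iff_forall] at hx ⊢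
  intro U hU
  obtain ⟨W, hWU, hW, hxW⟩ := mem_nhds_iff.1 hU
  have := hx (f ⁻¹' W) (hfc.continuousAt.preimage_mem_nhds (hW.mem_nhds hxW))
  rw [hf.measure_preimage hW.measurableSet.nullMeasurableSet] at this
  exact this.trans_le (measure_mono hWU)

end SingularSuspension

theorem mainTheorem8
    {E : Type*} [NormedAddCommGroup E] [NormedSpace ℝ E] [FiniteDimensional ℝ E]
    {M : Type*} [TopologicalSpace M] [ChartedSpace E M] [IsManifold 𝓘(ℝ, E) ∞ M]
    [CompactSpace M] [T2Space M] [MeasurableSpace M] [BorelSpace M]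
    (f : M ≃ₘ^1⟮𝓘(ℝ, E), 𝓘(ℝ, E)⟯ M) (ρ : SingularSuspension.Roof E M)
    (α : SingularSuspension.Susp f ρ → ℝ) (ψ : Flow ℝ (SingularSuspension.Susp f ρ))
    (hψ : SingularSuspension.IsSingularSuspension α ψ)
    (μ : MeasureTheory.Measure M) [MeasureTheory.IsProbabilityMeasure μ]
    (hμ : Ergodic f μ) (hatom : ∀ x : M, μ {x} = 0)
    (hent : 0 < SingularSuspension.metricEntropy f μ)
    (hsupp : Disjoint μ.support (SingularSuspension.singShadow α))
    (d : MetricSpace (SingularSuspension.Susp f ρ))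
    (hd : d.toPseudoMetricSpace.toUniformSpace.toTopologicalSpace =
      SingularSuspension.suspTopology f ρ) :
    0 < @SingularSuspension.topEntropy _ d (ψ 1) := by
  have : IsManifold 𝓘(ℝ, E) 1 M := .of_le (n := ∞) (by simp)
  have : SecondCountableTopology M := ChartedSpace.secondCountable_of_sigmaCompact E M
  have hD := @continuous_dist _ d.toPseudoMetricSpace
  rw [hd] at hD
  have hD0 : ∀ p q, d.dist p q ≤ 0 ↔ p = q := fun p q => @dist_le_zero _ d p q
  have hf := hμ.toMeasurePreserving
  exact @SingularSuspension.topEntropy_pos_of_shadowing _ d (ψ 1) M _ _ _ _ f μ _ hf hent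
    μ.support MeasureTheory.Measure.support_mem_ae (fun x => SingularSuspension.mk f ρ (x, 0))
    fun V hV hdiag => SingularSuspension.exists_iterate_close_of_disjoint_singShadow hψ
      MeasureTheory.Measure.isClosed_support.isCompact
      (SingularSuspension.mapsTo_support f.continuous hf) hsupp hD hD0 hV hdiag
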